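/- Let $s\ge 1$ and $m\ge 2$ be integers, $d=s^2$, and let $L_1,\dots,L_m$ be $s\times s$ arrays with entries in a set of $s$ symbols, each of which is either a Latin square (every symbol occurs exactly once in each row and in each column), or the square in which each symbol fills an entire row, or the square in which each symbol fills an entire column (up to renaming symbols). Assume that they are pairwise orthogonal, i.e. for $t\neq t'$ every pair of symbols $(u,v)$ equals $((L_t)_{ij},(L_{t'})_{ij})$ for some cell $(i,j)$. For each $t$ and each symbol $\ell$, number the $s$ cells of $L_t$ containing $\ell$ (in any order) as $c^{t,\ell}_0,\dots,c^{t,\ell}_{s-1}$, and for $r\in\{0,\dots,s-1\}$ put $$|b^t_{r,\ell}\rangle=\frac1{\sqrt s}\sum_{a=0}^{s-1}\omega^{ra}\,|c^{t,\ell}_a\rangle\in\mathbb{C}^s\otimes\mathbb{C}^s,\qquad \omega=e^{2\pi i/s},$$ where $|c\rangle=|i,j\rangle$ for the cell $c=(i,j)$. Then $\mathcal{B}_t=\{|b^t_{k}\rangle\}_{k}$, $k=(r,\ell)$, $t=1,\dots,m$, are mutually unbiased orthonormal bases (the MUBs constructed on the basis of Latin squares). Moreover, for the ensemble $\mathcal{E}=\{\frac1{dm},|b^t_k\rangle\langle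 b^t_k|\}_{t,k}$ (uniform prior on bases and basis elements), the accessible information $$\mathcal{I}_{acc}(\mathcal{E})=\max_M\bigl(H(P_A)+H(P_B)-H(P_{AB})\bigr),$$ where $M=\{M_i\}$ ranges over all POVMs with finitely many outcomes, $P_{AB}((t,k),i)=\frac1{dm}\langle b^t_k|M_i|b^t_k\rangle$ with marginals $P_A$, $P_B$, and $H$ is the Shannon entropy (logarithms to base $2$), is attained and equals $$\mathcal{I}_{acc}(\mathcal{E})=\frac{\log d}{2}.$$ The measurement $\{|i,j\rangle\langle i,j|\}$ in the computational basis attains this maximum. -/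

import Mathlib

open scoped ComplexOrder

namespace LSLocking

/-! ### Latin squares and orthogonality -/

/-- An `s × s` square array over the symbol set `Fin s`; `L (i, j)` is the entry in row `i` and
column `j`. -/
abbrev Square (s : ℕ) : Type := Fin s × Fin s → Fin s

/-- In each row and in each column every symbol occurs exactly once. -/
def IsLatin {s : ℕ} (L : Square s) : Prop :=
  (∀ i, Function.Bijective fun j => L (i, j)) ∧ (∀ j, Function.Bijective fun i => L (i, j))

/-- The (non-Latin) square in which each symbol fills an entire row. -/
def IsRowSquare {s : ℕ} (L : Square s) : Prop :=
  ∃ σ : Equiv.Perm (Fin s), ∀ i j, L (i, j) = σ i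

/-- The (non-Latin) square in which each symbol fills an entire column. -/
def IsColumnSquare {s : ℕ} (L : Square s) : Prop :=
  ∃ σ : Equiv.Perm (Fin s), ∀ i j, L (i, j) = σ j

/-- `{(L i j, L' i j) | i, j} = {(u, v) | u, v}`. -/
def AreOrthogonal {s : ℕ} (L L' : Square s) : Prop :=
  Set.range (fun c : Fin s × Fin s => (L c, L' c)) = Set.univ

/-! ### The basis of `ℂ^s ⊗ ℂ^s` obtained from a square -/

/-- An enumeration, for each symbol `ℓ`, of the `s` cells that contain `ℓ`; it decides which entry
of a row of the Hadamard matrix is attached to which cell. -/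
abbrev CellOrder {s : ℕ} (L : Square s) : Type := ∀ ℓ : Fin s, {c : Fin s × Fin s // L c = ℓ} ≃ Fin s

/-- The entry `h_{r a} = ω ^ (r a)`, `ω = exp (2 π i / s)`, of the `s × s` complex Hadamard matrix
(rows and columns numbered from `0`). -/
noncomputable def hadamard (s : ℕ) (r a : Fin s) : ℂ :=
  Complex.exp (2 * Real.pi * Complex.I / s) ^ ((r : ℕ) * (a : ℕ))

/-- The vectors `v_{r, ℓ} = (1/√s) ∑_{c : L c = ℓ} h_{r, a(c)} |c⟩`, where `a(c)` is the number of
the cell `c` among the cells containing `ℓ`. The space `ℂ^s ⊗ ℂ^s` is `ℂ^(s × s)`, with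
computational basis `|i, j⟩`. For `r = 0` these are the plain vectors
`(1/√s) ∑_{c : L c = ℓ} |c⟩`. -/
noncomputable def squareBasis {s : ℕ} (L : Square s) (e : CellOrder L) (k : Fin s × Fin s) :
    EuclideanSpace ℂ (Fin s × Fin s) :=
  WithLp.toLp 2 fun c =>
    if h : L c = k.2 then ((1 / Real.sqrt s : ℝ) : ℂ) * hadamard s k.1 (e k.2 ⟨c, h⟩) else 0

/-- A family of mutually unbiased (orthonormal) bases of `ℂ^n`. -/
def IsMUBFamily {τ κ n : Type} [Fintype n] (b : τ → κ → EuclideanSpace ℂ n) : Prop :=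
  (∀ t, Orthonormal ℂ (b t) ∧ Submodule.span ℂ (Set.range (b t)) = ⊤) ∧
    ∀ t t', t ≠ t' → ∀ k l, ‖inner ℂ (b t k) (b t' l)‖ = 1 / Real.sqrt (Fintype.card n)

/-! ### Measurements and accessible information -/

/-- The operator `|v⟩⟨v|`. -/
def ketbra {n : Type} (v : EuclideanSpace ℂ n) : Matrix n n ℂ :=
  Matrix.vecMulVec v.ofLp (star v.ofLp)

/-- A POVM on `ℂ^n` with (finite) outcome set `ι`. -/
structure POVM (ι n : Type) [Fintype ι] [Fintype n] [DecidableEq n] where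
  effect : ι → Matrix n n ℂ
  posSemidef : ∀ i, (effect i).PosSemidef
  sum_effect : ∑ i, effect i = 1

/-- The measurement `{|c⟩⟨c|}` in the computational basis. -/
noncomputable def computationalPOVM (n : Type) [Fintype n] [DecidableEq n] : POVM n n where
  effect c := ketbra (EuclideanSpace.single c 1)
  posSemidef c := Matrix.posSemidef_vecMulVec_self_star _
  sum_effect := by
    ext i j
    simp only [ketbra, Matrix.sum_apply, Matrix.vecMulVec_apply, Pi.star_apply,
      EuclideanSpace.single, Matrix.one_apply]
    by_cases h : i = j <;> simp [h]

/-- Shannon entropy in bits, with `0 log 0 = 0`. -/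
noncomputable def shannonEntropy {α : Type} [Fintype α] (P : α → ℝ) : ℝ :=
  -∑ a, P a * Real.logb 2 (P a)

/-- The joint distribution `P(x, i) = p_x tr (ρ_x M_i)` of the label `x` of the state drawn from the
ensemble `{p_x, ρ_x}` and of the outcome `i` of the measurement `M`. -/
noncomputable def jointDist {X ι n : Type} [Fintype ι] [Fintype n] [DecidableEq n]
    (p : X → ℝ) (ρ : X → Matrix n n ℂ) (M : POVM ι n) (xi : X × ι) : ℝ :=
  p xi.1 * (Matrix.trace (ρ xi.1 * M.effect xi.2)).re

/-- The classical mutual information `H(P_A) + H(P_B) - H(P_AB)` between the label of the state and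
the measurement outcome. -/
noncomputable def mutualInfo {X ι n : Type} [Fintype X] [Fintype ι] [Fintype n] [DecidableEq n]
    (p : X → ℝ) (ρ : X → Matrix n n ℂ) (M : POVM ι n) : ℝ :=
  shannonEntropy (fun x => ∑ i, jointDist p ρ M (x, i)) +
    shannonEntropy (fun i => ∑ x, jointDist p ρ M (x, i)) - shannonEntropy (jointDist p ρ M)

/-- `a` is the accessible information of the ensemble `{p_x, ρ_x}`: the maximum, over all POVMs, of
the mutual information between label and outcome. -/
def IsAccessibleInfo {X n : Type} [Fintype X] [Fintype n] [DecidableEq n]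
    (p : X → ℝ) (ρ : X → Matrix n n ℂ) (a : ℝ) : Prop :=
  IsGreatest {I : ℝ | ∃ (ι : Type) (_ : Fintype ι) (M : POVM ι n), I = mutualInfo p ρ M} a

end LSLocking

/-! Basis vectors of one square with different symbols have disjoint supports; those with the same
symbol are orthogonal like the rows of the Fourier matrix. For orthogonal squares two supports share
exactly one cell, so all overlaps are `1 / s = 1 / √d`.

For an effect `M` with trace `T`, put `h_t = ∑_k g log g`, where `g = ⟨b^t_k|M|b^t_k⟩`. By
`mutualInfo_eq` the information is, in nats, `log d + (1/dm) ∑_i ∑_t h_t - (1/d) ∑_i T_i log T_i`.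
The Maassen–Uffink relation gives `h_t + h_t' ≤ 2 T (log T - (log d)/2)` for `t ≠ t'`. Averaging
over pairs and summing over the outcomes cancels `T log T` and leaves `(log d)/2`. In the
computational basis `T = 1` and `h_t = -log s = -(log d)/2`, so equality holds.

Maassen–Uffink itself (`sum_weight_mul_log_add_le`) comes from the three lines theorem, applied to
an exponential sum `f` whose value at `0` attains the bound on the left edge. Comparing slopes at
`0` turns the norm bound into an entropy bound. -/

namespace LSLocking

/-! ### The Maassen–Uffink inequality -/

section EntropicUncertainty

/-- If `g` vanishes at `0` and is nonnegative on `[0, 1]`, its derivative at `0` is nonnegative. -/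
lemma deriv_nonneg_of_nonneg_right {g : ℝ → ℝ} {g' : ℝ} (hg : HasDerivAt g g' 0) (h0 : g 0 = 0)
    (hnn : ∀ x ∈ Set.Icc (0 : ℝ) 1, 0 ≤ g x) : 0 ≤ g' := by
  have h := (hasDerivAt_iff_tendsto_slope_left_right.1 hg).2
  refine ge_of_tendsto h ?_
  filter_upwards [Ioc_mem_nhdsGT (zero_lt_one : (0 : ℝ) < 1)] with x hx
  have := hnn x ⟨hx.1.le, hx.2⟩
  rw [slope_def_field, h0]
  simp only [sub_zero]
  exact div_nonneg this hx.1.le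

/-- A function that is dominated on `[0, 1]` by the logarithmic interpolation between `A = f 0` and
`B` has at most the slope of the interpolation at `0`. -/
lemma re_deriv_le_of_norm_le_interp {f : ℂ → ℂ} {f' : ℂ} (hf : HasDerivAt f f' 0) {A B : ℝ}
    (hA : 0 < A) (hB : 0 < B) (h0 : f 0 = A)
    (hle : ∀ x ∈ Set.Icc (0 : ℝ) 1, ‖f x‖ ≤ A ^ (1 - x) * B ^ x) :
    f'.re ≤ A * (Real.log B - Real.log A) := by
  set w := Real.log B - Real.log A
  have hint : ∀ x : ℝ, A ^ (1 - x) * B ^ x = A * Real.exp (x * w) := by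
    intro x
    rw [Real.rpow_def_of_pos hA, Real.rpow_def_of_pos hB, ← Real.exp_add]
    conv_rhs => rw [← Real.exp_log hA]
    rw [← Real.exp_add]
    congr 1
    simp only [w]
    ring
  have h1 : HasDerivAt (fun x : ℝ => (f x).re) f'.re 0 := by
    have : HasDerivAt f f' ((0 : ℝ) : ℂ) := by simpa using hf
    exact this.real_of_complex
  have h2 : HasDerivAt (fun x : ℝ => A * Real.exp (x * w)) (A * w) 0 := by
    have := (((hasDerivAt_id (0 : ℝ)).mul_const w).exp).const_mul A
    simpa using this
  have h3 := deriv_nonneg_of_nonneg_right (h2.sub h1) (by simp [h0]) (fun x hx => by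
    have := (Complex.re_le_norm _).trans ((hle x hx).trans_eq (hint x))
    simpa using this)
  linarith

/-! ### Edge estimates and marginals of the interpolating exponential sum -/

variable {E κ κ' J : Type*} [NormedAddCommGroup E] [InnerProductSpace ℂ E] [Fintype κ]
  [Fintype κ'] [Fintype J]

lemma norm_sum_smul_eq (a : OrthonormalBasis κ ℂ E) (v : E) (x : κ → ℂ) (hx : ∀ k, ‖x k‖ = 1) :
    ‖∑ k, (x k * inner ℂ (a k) v) • a k‖ = ‖v‖ := by
  have h : ‖∑ k, (x k * inner ℂ (a k) v) • a k‖ ^ 2 = ‖v‖ ^ 2 := by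
    rw [← a.sum_sq_norm_inner_right, ← a.sum_sq_norm_inner_right v]
    refine Finset.sum_congr rfl fun k _ => ?_
    rw [a.orthonormal.inner_right_fintype, norm_mul, hx, one_mul]
  exact (sq_eq_sq₀ (norm_nonneg _) (norm_nonneg _)).1 h

/-- The double sum is an inner product of two images of `v` under unitaries diagonal in `a` and in
`b`; Cauchy–Schwarz finishes. It controls the edge `Re z = 0`. -/
lemma norm_phase_sum_le (a : OrthonormalBasis κ ℂ E) (b : OrthonormalBasis κ' ℂ E) (v : E)
    (x : κ → ℂ) (y : κ' → ℂ) (hx : ∀ k, ‖x k‖ = 1) (hy : ∀ l, ‖y l‖ = 1) :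
    ‖∑ k, ∑ l, x k * y l * (inner ℂ v (a k) * inner ℂ (a k) (b l) * inner ℂ (b l) v)‖
      ≤ ‖v‖ ^ 2 := by
  have h : ∑ k, ∑ l, x k * y l * (inner ℂ v (a k) * inner ℂ (a k) (b l) * inner ℂ (b l) v)
      = inner ℂ (∑ k, (starRingEnd ℂ (x k) * inner ℂ (a k) v) • a k : E)
          (∑ l, (y l * inner ℂ (b l) v) • b l : E) := by
    simp only [sum_inner, inner_sum, inner_smul_left, inner_smul_right, map_mul,
      inner_conj_symm, Complex.conj_conj]
    rw [Finset.sum_comm]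
    refine Finset.sum_congr rfl fun l _ => ?_
    rw [Finset.mul_sum]
    refine Finset.sum_congr rfl fun k _ => ?_
    ring
  rw [h]
  refine (norm_inner_le_norm _ _).trans_eq ?_
  rw [norm_sum_smul_eq a v _ (by simpa using hx), norm_sum_smul_eq b v _ hy, sq]

/-- The weight `∑ j, |⟨u, v j⟩|²` of a unit vector `u` in the operator `∑ j, |v j⟩⟨v j|`. -/
noncomputable def weight (v : J → E) (u : E) : ℝ := ∑ j, ‖(inner ℂ u (v j) : ℂ)‖ ^ 2

lemma weight_nonneg (v : J → E) (u : E) : 0 ≤ weight v u :=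
  Finset.sum_nonneg fun _ _ => by positivity

lemma sum_weight (v : J → E) (a : OrthonormalBasis κ ℂ E) :
    ∑ k, weight v (a k) = ∑ j, ‖v j‖ ^ 2 := by
  simp only [weight]
  rw [Finset.sum_comm]
  exact Finset.sum_congr rfl fun j _ => a.sum_sq_norm_inner_right (v j)

/-- Cauchy–Schwarz over `j`, for the edge `Re z = 1`. -/
lemma norm_sum_inner_mul_inner_le (v : J → E) (u w : E) :
    ‖∑ j, (inner ℂ (v j) u : ℂ) * inner ℂ w (v j)‖ ≤ √(weight v u) * √(weight v w) := by
  refine (norm_sum_le _ _).trans ?_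
  have := Real.sum_mul_le_sqrt_mul_sqrt Finset.univ (fun j => ‖(inner ℂ u (v j) : ℂ)‖)
    (fun j => ‖(inner ℂ w (v j) : ℂ)‖)
  refine le_trans (le_of_eq ?_) this
  exact Finset.sum_congr rfl fun j _ => by rw [norm_mul, norm_inner_symm]

lemma exp_half_log_mul_sqrt {p : ℝ} (hp : 0 ≤ p) :
    Real.exp (Real.log p / 2) * √p = p := by
  rcases hp.eq_or_lt with rfl | hp
  · simp
  · rw [← Real.log_sqrt hp.le, Real.exp_log (Real.sqrt_pos.2 hp), Real.mul_self_sqrt hp.le]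

/-- The coefficients of the exponential sum that interpolates between the two bases. -/
noncomputable def transitionCoeff (v : J → E) (u w : E) : ℂ :=
  inner ℂ u w * ∑ j, inner ℂ (v j) u * inner ℂ w (v j)

/-- `transitionCoeff` is the Kirkwood–Dirac quasi-distribution of `∑ j, |v j⟩⟨v j|`: complex-valued,
but Parseval makes its marginals the true weights. -/
lemma sum_transitionCoeff_right (v : J → E) (u : E) (b : OrthonormalBasis κ' ℂ E) :
    ∑ l, transitionCoeff v u (b l) = weight v u := by
  simp only [transitionCoeff, Finset.mul_sum]
  rw [Finset.sum_comm, weight, Complex.ofReal_sum]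
  refine Finset.sum_congr rfl fun j _ => ?_
  have h : ∀ l, inner ℂ u (b l) * (inner ℂ (v j) u * inner ℂ (b l) (v j))
      = inner ℂ (v j) u * (inner ℂ u (b l) * inner ℂ (b l) (v j)) := fun l => by ring
  simp only [h]
  rw [← Finset.mul_sum, b.sum_inner_mul_inner, ← inner_conj_symm (v j) u, Complex.conj_mul']
  push_cast
  rfl

lemma sum_transitionCoeff_left (v : J → E) (a : OrthonormalBasis κ ℂ E) (w : E) :
    ∑ k, transitionCoeff v (a k) w = weight v w := by
  simp only [transitionCoeff, Finset.mul_sum]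
  rw [Finset.sum_comm, weight, Complex.ofReal_sum]
  refine Finset.sum_congr rfl fun j _ => ?_
  have h : ∀ k, inner ℂ (a k) w * (inner ℂ (v j) (a k) * inner ℂ w (v j))
      = (inner ℂ (v j) (a k) * inner ℂ (a k) w) * inner ℂ w (v j) := fun k => by ring
  simp only [h]
  rw [← Finset.sum_mul, a.sum_inner_mul_inner, ← inner_conj_symm (v j) w, Complex.conj_mul']
  push_cast
  rfl

/-- The Maassen–Uffink entropic uncertainty relation, for the unnormalised mixed state
`∑ j, |v j⟩⟨v j|`. -/
theorem sum_weight_mul_log_add_le (v : J → E) (a : OrthonormalBasis κ ℂ E)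
    (b : OrthonormalBasis κ' ℂ E) {c : ℝ} (hc : 0 < c)
    (hab : ∀ k l, ‖(inner ℂ (a k) (b l) : ℂ)‖ ≤ c) :
    ∑ k, weight v (a k) * Real.log (weight v (a k))
        + ∑ l, weight v (b l) * Real.log (weight v (b l))
      ≤ (∑ j, ‖v j‖ ^ 2) * (2 * Real.log (∑ j, ‖v j‖ ^ 2) + 2 * Real.log c) := by
  set τ := ∑ j, ‖v j‖ ^ 2 with hτ
  have hτa : ∑ k, weight v (a k) = τ := sum_weight v a
  have hτb : ∑ l, weight v (b l) = τ := sum_weight v b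
  have hτ0 : 0 ≤ τ := Finset.sum_nonneg fun _ _ => by positivity
  -- Logarithmic interpolation needs `τ > 0`; for `τ = 0` all weights vanish.
  rcases hτ0.eq_or_lt with h0 | hpos
  · have ha : ∀ k, weight v (a k) = 0 := fun k =>
      (Finset.sum_eq_zero_iff_of_nonneg fun k _ => weight_nonneg v (a k)).1 (hτa.trans h0.symm) k
        (Finset.mem_univ k)
    have hb : ∀ l, weight v (b l) = 0 := fun l =>
      (Finset.sum_eq_zero_iff_of_nonneg fun l _ => weight_nonneg v (b l)).1 (hτb.trans h0.symm) l
        (Finset.mem_univ l)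
    simp [ha, hb, ← h0]
  -- Thus `f z = ∑ p_k^(z/2) q_l^(z/2) G k l` with `p`, `q` the weights. A zero weight gets exponent
  -- `0` because `log 0 = 0`, which is harmless: the factor `√0` still kills its term on the right
  -- edge.
  set α : κ → ℝ := fun k => Real.log (weight v (a k)) / 2 with hα
  set β : κ' → ℝ := fun l => Real.log (weight v (b l)) / 2 with hβ
  set G : κ → κ' → ℂ := fun k l => transitionCoeff v (a k) (b l) with hG
  set f : ℂ → ℂ := fun z => ∑ k, ∑ l, Complex.exp (z * ((α k + β l : ℝ) : ℂ)) * G k l with hf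
  have hderiv : ∀ z, HasDerivAt f
      (∑ k, ∑ l, Complex.exp (z * ((α k + β l : ℝ) : ℂ)) * ((α k + β l : ℝ) : ℂ) * G k l) z := by
    intro z
    refine HasDerivAt.fun_sum fun k _ => HasDerivAt.fun_sum fun l _ => ?_
    have := (((hasDerivAt_id z).mul_const ((α k + β l : ℝ) : ℂ)).cexp).mul_const (G k l)
    simpa using this
  have hnexp : ∀ (z : ℂ) (w : ℝ), ‖Complex.exp (z * (w : ℂ))‖ = Real.exp (z.re * w) := by
    intro z w
    rw [Complex.norm_exp]
    simp
  have hbdd : BddAbove ((norm ∘ f) '' Complex.HadamardThreeLines.verticalClosedStrip 0 1) := by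
    refine ⟨∑ k, ∑ l, Real.exp |α k + β l| * ‖G k l‖, ?_⟩
    rintro _ ⟨z, hz, rfl⟩
    refine (norm_sum_le _ _).trans (Finset.sum_le_sum fun k _ => (norm_sum_le _ _).trans
      (Finset.sum_le_sum fun l _ => ?_))
    rw [norm_mul, hnexp]
    gcongr
    obtain ⟨h0, h1⟩ : 0 ≤ z.re ∧ z.re ≤ 1 := hz
    calc z.re * (α k + β l) ≤ |z.re * (α k + β l)| := le_abs_self _
      _ = z.re * |α k + β l| := by rw [abs_mul, abs_of_nonneg h0]
      _ ≤ 1 * |α k + β l| := by gcongr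
      _ = _ := one_mul _
  -- For `Re z = 0` the exponentials are phases.
  have hleft : ∀ z ∈ Complex.re ⁻¹' {0}, ‖f z‖ ≤ τ := by
    intro z hz
    have hz : z.re = 0 := hz
    have hfz : f z = ∑ j, ∑ k, ∑ l, Complex.exp (z * (α k : ℂ)) * Complex.exp (z * (β l : ℂ)) *
        (inner ℂ (v j) (a k) * inner ℂ (a k) (b l) * inner ℂ (b l) (v j)) := by
      rw [Finset.sum_comm]
      refine Finset.sum_congr rfl fun k _ => ?_
      rw [Finset.sum_comm]
      refine Finset.sum_congr rfl fun l _ => ?_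
      simp only [hG, transitionCoeff, Finset.mul_sum]
      refine Finset.sum_congr rfl fun j _ => ?_
      rw [Complex.ofReal_add, mul_add, Complex.exp_add]
      ring
    rw [hfz]
    refine (norm_sum_le _ _).trans (Finset.sum_le_sum fun j _ => ?_)
    exact norm_phase_sum_le a b (v j) _ _ (fun k => by simp [hnexp, hz])
      (fun l => by simp [hnexp, hz])
  -- For `Re z = 1` each exponential has modulus `√p` (if `p > 0`); the other `√p` comes from
  -- Cauchy–Schwarz, and the overlap contributes `c`.
  have hright : ∀ z ∈ Complex.re ⁻¹' {1}, ‖f z‖ ≤ c * τ ^ 2 := by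
    intro z hz
    have hz : z.re = 1 := hz
    calc ‖f z‖ ≤ ∑ k, ∑ l, c * (weight v (a k) * weight v (b l)) := by
          refine (norm_sum_le _ _).trans (Finset.sum_le_sum fun k _ => (norm_sum_le _ _).trans
            (Finset.sum_le_sum fun l _ => ?_))
          simp only [hG, transitionCoeff]
          rw [norm_mul, hnexp, hz, one_mul, Real.exp_add, norm_mul]
          calc _ ≤ Real.exp (α k) * Real.exp (β l)
                * (c * (√(weight v (a k)) * √(weight v (b l)))) := by
                gcongr
                · exact hab k l
                · exact norm_sum_inner_mul_inner_le v (a k) (b l)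
            _ = c * ((Real.exp (α k) * √(weight v (a k)))
                * (Real.exp (β l) * √(weight v (b l)))) := by ring
            _ = _ := by
                rw [hα, hβ, exp_half_log_mul_sqrt (weight_nonneg v _),
                  exp_half_log_mul_sqrt (weight_nonneg v _)]
      _ = c * τ ^ 2 := by
          simp only [← Finset.mul_sum, ← Finset.sum_mul, hτa, hτb]
          ring
  have hdiff : DiffContOnCl ℂ f (Complex.HadamardThreeLines.verticalStrip 0 1) :=
    Differentiable.diffContOnCl fun z => (hderiv z).differentiableAt
  have hle : ∀ x ∈ Set.Icc (0 : ℝ) 1, ‖f x‖ ≤ τ ^ (1 - x) * (c * τ ^ 2) ^ x := by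
    intro x hx
    have := Complex.HadamardThreeLines.norm_le_interp_of_mem_verticalClosedStrip₀₁' f
      (z := (x : ℂ)) (by
        simpa [Complex.HadamardThreeLines.verticalClosedStrip] using hx) hdiff hbdd hleft hright
    simpa using this
  -- Coefficients of the form `x k + y l` see only the marginals of `G`; this evaluates both `f 0`
  -- and `f' 0`.
  have hsplit : ∀ (x : κ → ℂ) (y : κ' → ℂ), ∑ k, ∑ l, (x k + y l) * G k l
      = ∑ k, x k * weight v (a k) + ∑ l, y l * weight v (b l) := by
    intro x y
    simp only [add_mul, Finset.sum_add_distrib]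
    congr 1
    · refine Finset.sum_congr rfl fun k _ => ?_
      rw [← Finset.mul_sum, sum_transitionCoeff_right]
    · rw [Finset.sum_comm]
      refine Finset.sum_congr rfl fun l _ => ?_
      rw [← Finset.mul_sum, sum_transitionCoeff_left]
  have hf0 : f 0 = τ := by
    have := hsplit 1 0
    simp only [Pi.one_apply, Pi.zero_apply, add_zero, one_mul, zero_mul, Finset.sum_const_zero]
      at this
    simp only [hf, zero_mul, Complex.exp_zero, one_mul]
    rw [this, ← Complex.ofReal_sum, hτa]
  -- The slope of the interpolation is `τ (log (c τ²) - log τ) = τ (log τ + log c)`; the halves in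
  -- `α` and `β` account for the remaining factor `2`.
  have hkey := re_deriv_le_of_norm_le_interp (hderiv 0) hpos (by positivity) hf0 hle
  have hd : (∑ k, ∑ l, Complex.exp (0 * ((α k + β l : ℝ) : ℂ)) * ((α k + β l : ℝ) : ℂ) * G k l)
      = ((∑ k, α k * weight v (a k) + ∑ l, β l * weight v (b l) : ℝ) : ℂ) := by
    have := hsplit (fun k => (α k : ℂ)) (fun l => (β l : ℂ))
    simp only [zero_mul, Complex.exp_zero, one_mul]
    push_cast
    exact this
  rw [hd, Complex.ofReal_re, Real.log_mul hc.ne' (by positivity), Real.log_pow] at hkey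
  have e1 : ∑ k, weight v (a k) * Real.log (weight v (a k)) = 2 * ∑ k, α k * weight v (a k) := by
    rw [Finset.mul_sum]
    exact Finset.sum_congr rfl fun k _ => by simp only [hα]; ring
  have e2 : ∑ l, weight v (b l) * Real.log (weight v (b l)) = 2 * ∑ l, β l * weight v (b l) := by
    rw [Finset.mul_sum]
    exact Finset.sum_congr rfl fun l _ => by simp only [hβ]; ring
  rw [e1, e2]
  push_cast at hkey
  linarith

end EntropicUncertainty

/-! ### The bases attached to squares are mutually unbiased -/

section SquareBasis

variable {s : ℕ}

lemma norm_hadamard (r a : Fin s) : ‖hadamard s r a‖ = 1 := by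
  have h : Complex.exp (2 * Real.pi * Complex.I / s)
      = Complex.exp ((2 * Real.pi / s : ℝ) * Complex.I) := by
    congr 1
    push_cast
    ring
  rw [hadamard, norm_pow, h, Complex.norm_exp_ofReal_mul_I, one_pow]

/-- The rows of the Hadamard matrix are orthogonal. -/
lemma sum_hadamard_mul_conj (hs : 0 < s) (r r' : Fin s) :
    ∑ a, hadamard s r' a * starRingEnd ℂ (hadamard s r a) = if r = r' then (s : ℂ) else 0 := by
  split_ifs with h
  · subst h
    simp [Complex.mul_conj', norm_hadamard]
  set ζ := Complex.exp (2 * Real.pi * Complex.I / s) with hζ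
  have hprim : IsPrimitiveRoot ζ s := Complex.isPrimitiveRoot_exp s hs.ne'
  have hζ1 : ‖ζ‖ = 1 := hprim.norm'_eq_one hs.ne'
  have hζ0 : ζ ≠ 0 := hprim.ne_zero hs.ne'
  have hinv : starRingEnd ℂ ζ = ζ⁻¹ := (Complex.inv_eq_conj hζ1).symm
  -- The sum is geometric with ratio `x = ζ^(r' - r)`, a nontrivial `s`-th root of unity.
  set x : ℂ := ζ ^ (r' : ℕ) * (ζ ^ (r : ℕ))⁻¹ with hx
  have hterm : ∀ a : Fin s, hadamard s r' a * starRingEnd ℂ (hadamard s r a) = x ^ (a : ℕ) := by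
    intro a
    simp only [hadamard, ← hζ, map_pow, hinv, hx, mul_pow, pow_mul, inv_pow]
  have hx1 : x ≠ 1 := by
    intro hx1
    have : ζ ^ (r' : ℕ) = ζ ^ (r : ℕ) := by
      rw [hx] at hx1
      field_simp at hx1
      exact hx1
    exact h (Fin.ext (hprim.pow_inj r'.2 r.2 this).symm)
  have hxs : x ^ s = 1 := by
    rw [hx, mul_pow, inv_pow, ← pow_mul, ← pow_mul, mul_comm (r' : ℕ), mul_comm (r : ℕ), pow_mul,
      pow_mul, hprim.pow_eq_one]
    simp
  simp only [hterm]
  rw [Fin.sum_univ_eq_sum_range (fun a => x ^ a) s, geom_sum_eq hx1, hxs, sub_self, zero_div]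

lemma squareBasis_apply_of_eq (L : Square s) (e : CellOrder L) (k c : Fin s × Fin s)
    (h : L c = k.2) :
    squareBasis L e k c = ((1 / √(s : ℝ) : ℝ) : ℂ) * hadamard s k.1 (e k.2 ⟨c, h⟩) := by
  simp [squareBasis, h]

lemma squareBasis_apply_of_ne (L : Square s) (e : CellOrder L) (k c : Fin s × Fin s)
    (h : L c ≠ k.2) : squareBasis L e k c = 0 := by
  simp [squareBasis, h]

lemma norm_squareBasis_apply (L : Square s) (e : CellOrder L) (k c : Fin s × Fin s) :
    ‖squareBasis L e k c‖ = if L c = k.2 then 1 / √(s : ℝ) else 0 := by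
  split_ifs with h
  · rw [squareBasis_apply_of_eq L e k c h, norm_mul, norm_hadamard, mul_one, Complex.norm_real,
      Real.norm_of_nonneg (by positivity)]
  · rw [squareBasis_apply_of_ne L e k c h, norm_zero]

lemma inner_squareBasis_eq_sum (L L' : Square s) (e : CellOrder L) (e' : CellOrder L')
    (k k' : Fin s × Fin s) :
    (inner ℂ (squareBasis L e k) (squareBasis L' e' k') : ℂ)
      = ∑ c, squareBasis L' e' k' c * starRingEnd ℂ (squareBasis L e k c) := by
  simp [PiLp.inner_apply]

lemma orthonormal_squareBasis (hs : 0 < s) (L : Square s) (e : CellOrder L) :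
    Orthonormal ℂ (squareBasis L e) := by
  rw [orthonormal_iff_ite]
  rintro ⟨r, ℓ⟩ ⟨r', ℓ'⟩
  rw [inner_squareBasis_eq_sum]
  by_cases hℓ : ℓ = ℓ'
  · subst hℓ
    have hss : ((1 / √(s : ℝ) : ℝ) : ℂ) * ((1 / √(s : ℝ) : ℝ) : ℂ) = (s : ℂ)⁻¹ := by
      rw [← Complex.ofReal_mul, div_mul_div_comm, Real.mul_self_sqrt (by positivity)]
      simp
    calc ∑ c, squareBasis L e (r', ℓ) c * starRingEnd ℂ (squareBasis L e (r, ℓ) c)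
        = ∑ c : {c // L c = ℓ}, squareBasis L e (r', ℓ) c
            * starRingEnd ℂ (squareBasis L e (r, ℓ) c) := by
          rw [← Finset.sum_subtype (Finset.univ.filter fun c => L c = ℓ) (by simp)
            (fun c => squareBasis L e (r', ℓ) c * starRingEnd ℂ (squareBasis L e (r, ℓ) c))]
          refine (Finset.sum_filter_of_ne fun c _ hc => ?_).symm
          by_contra h
          exact hc (by rw [squareBasis_apply_of_ne L e (r', ℓ) c h, zero_mul])
      _ = ∑ c : {c // L c = ℓ}, (s : ℂ)⁻¹ *
            (hadamard s r' (e ℓ c) * starRingEnd ℂ (hadamard s r (e ℓ c))) := by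
          refine Finset.sum_congr rfl fun c _ => ?_
          rw [squareBasis_apply_of_eq L e (r', ℓ) c c.2, squareBasis_apply_of_eq L e (r, ℓ) c c.2,
            ← hss, map_mul, Complex.conj_ofReal]
          ring
      _ = (s : ℂ)⁻¹ * ∑ a, hadamard s r' a * starRingEnd ℂ (hadamard s r a) := by
          rw [← Finset.mul_sum, (e ℓ).sum_comp
            (fun a => hadamard s r' a * starRingEnd ℂ (hadamard s r a))]
      _ = _ := by
          rw [sum_hadamard_mul_conj hs]
          have : (s : ℂ) ≠ 0 := by exact_mod_cast hs.ne'
          by_cases h : r = r' <;> simp [h, this]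
  · rw [if_neg (by simp [hℓ])]
    refine Finset.sum_eq_zero fun c _ => ?_
    by_cases h : L c = ℓ'
    · rw [squareBasis_apply_of_ne L e (r, ℓ) c (by rw [h]; exact fun h => hℓ h.symm)]
      simp
    · rw [squareBasis_apply_of_ne L e (r', ℓ') c h, zero_mul]

lemma span_range_squareBasis (hs : 0 < s) (L : Square s) (e : CellOrder L) :
    Submodule.span ℂ (Set.range (squareBasis L e)) = ⊤ :=
  (orthonormal_squareBasis hs L e).linearIndependent.span_eq_top_of_card_eq_finrank' (by simp)

/-- Two cells of a pair of orthogonal squares that carry the same pair of symbols coincide. -/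
lemma AreOrthogonal.bijective {L L' : Square s} (h : AreOrthogonal L L') :
    Function.Bijective fun c : Fin s × Fin s => (L c, L' c) :=
  Finite.injective_iff_bijective.1 <| Finite.injective_iff_surjective.2 <| Set.range_eq_univ.1 h

/-- Only the unique cell carrying the symbol pair `(k.2, k'.2)` contributes, with modulus `(1/√s)²`.
-/
lemma norm_inner_squareBasis {L L' : Square s} (h : AreOrthogonal L L') (e : CellOrder L)
    (e' : CellOrder L') (k k' : Fin s × Fin s) :
    ‖(inner ℂ (squareBasis L e k) (squareBasis L' e' k') : ℂ)‖ = 1 / s := by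
  obtain ⟨c, hc⟩ := h.bijective.2 (k.2, k'.2)
  obtain ⟨h1, h2⟩ := Prod.ext_iff.1 hc
  simp only at h1 h2
  rw [inner_squareBasis_eq_sum, Finset.sum_eq_single c, norm_mul, RCLike.norm_conj,
    norm_squareBasis_apply, norm_squareBasis_apply, if_pos h1, if_pos h2, div_mul_div_comm,
    Real.mul_self_sqrt (by positivity), one_mul]
  · intro c' _ hne
    by_cases hk : L c' = k.2
    · rw [squareBasis_apply_of_ne L' e' k' c', zero_mul]
      exact fun hk' => hne (h.bijective.1 ((Prod.ext hk hk').trans hc.symm))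
    · rw [squareBasis_apply_of_ne L e k c' hk, map_zero, mul_zero]
  · simp

theorem isMUBFamily_squareBasis (hs : 0 < s) {τ : Type} (L : τ → Square s)
    (horth : ∀ t t', t ≠ t' → AreOrthogonal (L t) (L t')) (e : ∀ t, CellOrder (L t)) :
    IsMUBFamily fun t => squareBasis (L t) (e t) := by
  refine ⟨fun t => ⟨orthonormal_squareBasis hs _ _, span_range_squareBasis hs _ _⟩, ?_⟩
  intro t t' ht k l
  rw [norm_inner_squareBasis (horth t t' ht)]
  simp

end SquareBasis

/-! ### The mutual information of a measurement -/

section Information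

variable {τ κ n : Type} [Fintype τ] [Fintype κ] [Fintype n]

/-- The expectation value `⟨u|M|u⟩`. -/
noncomputable def expectation (M : Matrix n n ℂ) (u : EuclideanSpace ℂ n) : ℝ :=
  (Matrix.trace (ketbra u * M)).re

lemma expectation_sum {ι : Type*} [Fintype ι] (M : ι → Matrix n n ℂ) (u : EuclideanSpace ℂ n) :
    expectation (∑ i, M i) u = ∑ i, expectation (M i) u := by
  simp only [expectation, Matrix.mul_sum, Matrix.trace_sum, Complex.re_sum]

lemma expectation_ketbra (u w : EuclideanSpace ℂ n) :
    expectation (ketbra w) u = ‖(inner ℂ u w : ℂ)‖ ^ 2 := by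
  have h : Matrix.trace (ketbra u * ketbra w) = inner ℂ w u * inner ℂ u w := by
    rw [ketbra, ketbra, Matrix.vecMulVec_mul_vecMulVec, Matrix.trace_vecMulVec,
      EuclideanSpace.inner_eq_star_dotProduct, EuclideanSpace.inner_eq_star_dotProduct]
    simp [dotProduct_comm, mul_comm]
  rw [expectation, h, ← inner_conj_symm w u, Complex.conj_mul', ← Complex.ofReal_pow,
    Complex.ofReal_re]

/-- Lets the uncertainty relation apply to effects of any rank, with no refinement to a rank-one
POVM. -/
lemma exists_eq_sum_ketbra {M : Matrix n n ℂ} (hM : M.PosSemidef) :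
    ∃ (r : ℕ) (v : Fin r → EuclideanSpace ℂ n), M = ∑ j, ketbra (v j) := by
  obtain ⟨r, v, hv⟩ := Matrix.posSemidef_iff_eq_sum_vecMulVec.1 hM
  exact ⟨r, fun j => WithLp.toLp 2 (v j), hv⟩

lemma expectation_sum_ketbra {r : ℕ} (v : Fin r → EuclideanSpace ℂ n) (u : EuclideanSpace ℂ n) :
    expectation (∑ j, ketbra (v j)) u = weight v u := by
  simp only [expectation_sum, expectation_ketbra, weight]

variable [DecidableEq n]

lemma expectation_one (u : EuclideanSpace ℂ n) : expectation 1 u = ‖u‖ ^ 2 := by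
  rw [expectation, mul_one, ketbra, Matrix.trace_vecMulVec, ← inner_self_eq_norm_sq (𝕜 := ℂ),
    EuclideanSpace.inner_eq_star_dotProduct]
  rfl

lemma re_trace_ketbra (w : EuclideanSpace ℂ n) : (Matrix.trace (ketbra w)).re = ‖w‖ ^ 2 := by
  rw [← expectation_one, expectation, mul_one]

lemma re_trace_sum_ketbra {r : ℕ} (v : Fin r → EuclideanSpace ℂ n) :
    (Matrix.trace (∑ j, ketbra (v j))).re = ∑ j, ‖v j‖ ^ 2 := by
  simp only [Matrix.trace_sum, Complex.re_sum, re_trace_ketbra]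

lemma sum_expectation {M : Matrix n n ℂ} (hM : M.PosSemidef)
    (a : OrthonormalBasis κ ℂ (EuclideanSpace ℂ n)) :
    ∑ k, expectation M (a k) = (Matrix.trace M).re := by
  obtain ⟨r, v, rfl⟩ := exists_eq_sum_ketbra hM
  simp only [expectation_sum_ketbra, re_trace_sum_ketbra, sum_weight]

/-- The Maassen–Uffink relation, summed over all pairs of a family of mutually unbiased bases. -/
lemma sum_expectation_mul_log_le (a : τ → OrthonormalBasis κ ℂ (EuclideanSpace ℂ n))
    (hmub : IsMUBFamily fun t k => a t k) (hτ : 2 ≤ Fintype.card τ) (hn : 0 < Fintype.card n)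
    {M : Matrix n n ℂ} (hM : M.PosSemidef) :
    ∑ t, ∑ k, expectation M (a t k) * Real.log (expectation M (a t k))
      ≤ Fintype.card τ * ((Matrix.trace M).re *
        (Real.log (Matrix.trace M).re - Real.log (Fintype.card n) / 2)) := by
  classical
  obtain ⟨r, v, rfl⟩ := exists_eq_sum_ketbra hM
  simp only [expectation_sum_ketbra, re_trace_sum_ketbra]
  set h : τ → ℝ := fun t => ∑ k, weight v (a t k) * Real.log (weight v (a t k)) with hh
  set w := ∑ j, ‖v j‖ ^ 2
  set D := w * (Real.log w - Real.log (Fintype.card n) / 2)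
  have hd : (0 : ℝ) < Fintype.card n := by exact_mod_cast hn
  have hpair : ∀ t t', t ≠ t' → h t + h t' ≤ 2 * D := by
    intro t t' ht
    have := sum_weight_mul_log_add_le v (a t) (a t')
      (c := 1 / √(Fintype.card n)) (by positivity) (fun k l => (hmub.2 t t' ht k l).le)
    rw [one_div, Real.log_inv, Real.log_sqrt hd.le] at this
    refine this.trans_eq ?_
    simp only [D, w]
    ring
  -- Over ordered pairs of distinct bases each `h t` occurs `2 (m - 1)` times, with `m = card τ`;
  -- dividing by `m - 1` needs `m ≥ 2`.
  have hsum : ∑ t, ∑ t' ∈ Finset.univ.erase t, (h t + h t')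
      ≤ ∑ t : τ, ∑ _t' ∈ Finset.univ.erase t, 2 * D :=
    Finset.sum_le_sum fun t _ => Finset.sum_le_sum fun t' ht' =>
      hpair t t' (Finset.ne_of_mem_erase ht').symm
  have herase : ∀ t, ∑ t' ∈ Finset.univ.erase t, h t' = ∑ t', h t' - h t := fun t =>
    Finset.sum_erase_eq_sub (Finset.mem_univ t)
  have hcard : ∀ t : τ, ((Finset.univ.erase t).card : ℝ) = Fintype.card τ - 1 := fun t => by
    rw [Finset.card_erase_of_mem (Finset.mem_univ t), Finset.card_univ, Nat.cast_sub (by omega),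
      Nat.cast_one]
  simp only [Finset.sum_add_distrib, Finset.sum_const, nsmul_eq_mul, hcard, herase,
    Finset.sum_sub_distrib, ← Finset.mul_sum, Finset.card_univ] at hsum
  have hm : (0 : ℝ) < Fintype.card τ - 1 := by
    have : (2 : ℝ) ≤ Fintype.card τ := by exact_mod_cast hτ
    linarith
  have : (Fintype.card τ - 1 : ℝ) * ∑ t, h t ≤ (Fintype.card τ - 1) * (Fintype.card τ * D) := by
    nlinarith
  exact le_of_mul_le_mul_left this hm

lemma shannonEntropy_eq {α : Type} [Fintype α] (P : α → ℝ) :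
    shannonEntropy P = -(∑ x, P x * Real.log (P x)) / Real.log 2 := by
  simp only [shannonEntropy, Real.logb, neg_div, Finset.sum_div, mul_div_assoc]

lemma div_mul_log_div (x : ℝ) {N : ℝ} (hN : 0 < N) :
    x / N * Real.log (x / N) = x * Real.log x / N - x / N * Real.log N := by
  rcases eq_or_ne x 0 with rfl | hx
  · simp
  · rw [Real.log_div hx hN.ne']
    ring

/-- The mutual information for the uniform ensemble of the elements of a family of orthonormal
bases. -/
lemma mutualInfo_eq (a : τ → OrthonormalBasis κ ℂ (EuclideanSpace ℂ n))
    (hτ : 0 < Fintype.card τ) (hn : 0 < Fintype.card n) {p : τ × κ → ℝ}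
    (hp : ∀ x, p x = 1 / ((Fintype.card n : ℝ) * Fintype.card τ))
    {ρ : τ × κ → Matrix n n ℂ} (hρ : ∀ x, ρ x = ketbra (a x.1 x.2))
    {ι : Type} [Fintype ι] (M : POVM ι n) :
    mutualInfo p ρ M =
      ((∑ i, ∑ t, ∑ k, expectation (M.effect i) (a t k) *
            Real.log (expectation (M.effect i) (a t k))) / (Fintype.card n * Fintype.card τ)
        - (∑ i, (Matrix.trace (M.effect i)).re * Real.log (Matrix.trace (M.effect i)).re)
            / Fintype.card n
        + Real.log (Fintype.card n)) / Real.log 2 := by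
  set d : ℝ := (Fintype.card n : ℝ) with hd_def
  set m : ℝ := (Fintype.card τ : ℝ) with hm_def
  have hd : 0 < d := by simpa [hd_def] using hn
  have hm : 0 < m := by simpa [hm_def] using hτ
  have hN : 0 < d * m := mul_pos hd hm
  set g : τ × κ → ι → ℝ := fun x i => expectation (M.effect i) (a x.1 x.2) with hg
  set T : ι → ℝ := fun i => (Matrix.trace (M.effect i)).re with hT
  have hJ : ∀ x i, jointDist p ρ M (x, i) = g x i / (d * m) := by
    intro x i
    simp only [jointDist, hp, hρ, hg, expectation]
    ring
  -- Any one of the bases shows that `κ` has `d` elements; `hτ` supplies one.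
  have hκ : (Fintype.card κ : ℝ) = d := by
    have := Module.finrank_eq_card_basis (a (Fintype.card_pos_iff.1 hτ).some).toBasis
    rw [finrank_euclideanSpace] at this
    rw [hd_def, this]
  have hgi : ∀ x, ∑ i, g x i = 1 := by
    intro x
    simp only [hg]
    rw [← expectation_sum, M.sum_effect, expectation_one, (a x.1).orthonormal.1, one_pow]
  have hgx : ∀ i, ∑ x, g x i = m * T i := by
    intro i
    rw [Fintype.sum_prod_type]
    simp only [hg, sum_expectation (M.posSemidef i), Finset.sum_const, Finset.card_univ,
      nsmul_eq_mul, hm_def, hT]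
  have hTsum : ∑ i, T i = d := by
    simp only [hT]
    rw [← Complex.re_sum, ← Matrix.trace_sum, M.sum_effect, Matrix.trace_one]
    simp [hd_def]
  have hcard : (Fintype.card (τ × κ) : ℝ) = d * m := by
    rw [Fintype.card_prod, Nat.cast_mul, hκ, mul_comm]
  have hA : ∀ x, ∑ i, jointDist p ρ M (x, i) = 1 / (d * m) := fun x => by
    simp only [hJ, ← Finset.sum_div, hgi]
  have hB : ∀ i, ∑ x, jointDist p ρ M (x, i) = T i / d := fun i => by
    simp only [hJ, ← Finset.sum_div, hgx]
    field_simp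
  have eA : ∑ _x : τ × κ, 1 / (d * m) * Real.log (1 / (d * m)) = -Real.log (d * m) := by
    rw [Finset.sum_const, Finset.card_univ, nsmul_eq_mul, hcard, one_div, Real.log_inv]
    field_simp
  have eB : ∑ i, T i / d * Real.log (T i / d) = (∑ i, T i * Real.log (T i)) / d - Real.log d := by
    simp only [div_mul_log_div _ hd, Finset.sum_sub_distrib, ← Finset.sum_div, ← Finset.sum_mul,
      hTsum, div_self hd.ne', one_mul]
  have eAB : ∑ y : (τ × κ) × ι, jointDist p ρ M y * Real.log (jointDist p ρ M y)
      = (∑ i, ∑ t, ∑ k, g (t, k) i * Real.log (g (t, k) i)) / (d * m) - Real.log (d * m) := by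
    rw [Fintype.sum_prod_type]
    simp only [hJ, div_mul_log_div _ hN, Finset.sum_sub_distrib, ← Finset.sum_div,
      ← Finset.sum_mul, hgi, Finset.sum_const, Finset.card_univ, nsmul_eq_mul, hcard, mul_one,
      div_self hN.ne', one_mul]
    rw [Finset.sum_comm]
    simp only [Fintype.sum_prod_type]
  rw [mutualInfo, shannonEntropy_eq, shannonEntropy_eq, shannonEntropy_eq, eAB]
  simp only [hA, hB]
  rw [eA, eB]
  ring

/-- No measurement yields more than half of the maximal information on the elements of a uniformly
distributed family of at least two mutually unbiased bases. -/
theorem mutualInfo_le_half_log (a : τ → OrthonormalBasis κ ℂ (EuclideanSpace ℂ n))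
    (hmub : IsMUBFamily fun t k => a t k) (hτ : 2 ≤ Fintype.card τ) (hn : 0 < Fintype.card n)
    {p : τ × κ → ℝ} (hp : ∀ x, p x = 1 / ((Fintype.card n : ℝ) * Fintype.card τ))
    {ρ : τ × κ → Matrix n n ℂ} (hρ : ∀ x, ρ x = ketbra (a x.1 x.2))
    {ι : Type} [Fintype ι] (M : POVM ι n) :
    mutualInfo p ρ M ≤ Real.logb 2 (Fintype.card n) / 2 := by
  have hd : (0 : ℝ) < Fintype.card n := by exact_mod_cast hn
  have hm : (0 : ℝ) < Fintype.card τ := by exact_mod_cast (by omega : 0 < Fintype.card τ)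
  have hTsum : ∑ i, (Matrix.trace (M.effect i)).re = Fintype.card n := by
    rw [← Complex.re_sum, ← Matrix.trace_sum, M.sum_effect, Matrix.trace_one]
    simp
  have hsum := Finset.sum_le_sum fun i (_ : i ∈ Finset.univ) =>
    sum_expectation_mul_log_le a hmub hτ hn (M.posSemidef i)
  rw [← Finset.mul_sum] at hsum
  simp only [mul_sub, Finset.sum_sub_distrib, ← Finset.sum_mul, hTsum] at hsum
  rw [mutualInfo_eq a (by omega) hn hp hρ M, Real.logb, div_right_comm]
  have h2 : 0 < Real.log 2 := Real.log_pos one_lt_two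
  refine div_le_div_of_nonneg_right ?_ h2.le
  have h3 := div_le_div_of_nonneg_right hsum (mul_pos hd hm).le
  -- The terms `T log T` cancel, leaving `log d - (log d)/2`.
  refine (add_le_add_left (sub_le_sub_right h3 _) _).trans_eq ?_
  field_simp
  ring

end Information

/-! ### Attainment in the computational basis -/

lemma mutualInfo_computationalPOVM {s m : ℕ} (hs : 0 < s) (hm : 0 < m) (L : Fin m → Square s)
    (e : ∀ t, CellOrder (L t))
    (a : Fin m → OrthonormalBasis (Fin s × Fin s) ℂ (EuclideanSpace ℂ (Fin s × Fin s)))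
    (ha : ∀ t k, a t k = squareBasis (L t) (e t) k) {p : Fin m × (Fin s × Fin s) → ℝ}
    (hp : ∀ x, p x = 1 / ((Fintype.card (Fin s × Fin s) : ℝ) * Fintype.card (Fin m)))
    {ρ : Fin m × (Fin s × Fin s) → Matrix (Fin s × Fin s) (Fin s × Fin s) ℂ}
    (hρ : ∀ x, ρ x = ketbra (a x.1 x.2)) :
    mutualInfo p ρ (computationalPOVM (Fin s × Fin s)) = Real.logb 2 ((s : ℝ) ^ 2) / 2 := by
  have hs' : (0 : ℝ) < s := by exact_mod_cast hs
  have hm' : (0 : ℝ) < m := by exact_mod_cast hm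
  have hT : ∀ c, (Matrix.trace ((computationalPOVM (Fin s × Fin s)).effect c)).re = 1 := by
    intro c
    rw [computationalPOVM, re_trace_ketbra]
    simp
  have hg : ∀ c t k, expectation ((computationalPOVM (Fin s × Fin s)).effect c) (a t k)
      = if L t c = k.2 then 1 / (s : ℝ) else 0 := by
    intro c t k
    rw [computationalPOVM, expectation_ketbra, norm_inner_symm, EuclideanSpace.inner_single_left,
      map_one, one_mul, ha, norm_squareBasis_apply]
    split_ifs
    · rw [div_pow, Real.sq_sqrt hs'.le, one_pow]
    · simp
  have hsum : ∀ c t, ∑ k, expectation ((computationalPOVM (Fin s × Fin s)).effect c) (a t k)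
      * Real.log (expectation ((computationalPOVM (Fin s × Fin s)).effect c) (a t k))
      = -Real.log s := by
    intro c t
    have : ∀ k : Fin s × Fin s, (if L t c = k.2 then 1 / (s : ℝ) else 0)
        * Real.log (if L t c = k.2 then 1 / (s : ℝ) else 0)
        = if L t c = k.2 then 1 / (s : ℝ) * Real.log (1 / s) else 0 := by
      intro k
      split_ifs <;> simp
    simp only [hg, this]
    -- For each `r` only `ℓ = L t c` contributes, giving `s` equal terms `(1/s) log (1/s)`.
    rw [Fintype.sum_prod_type]
    simp only [Finset.sum_ite_eq, Finset.mem_univ, if_true, Finset.sum_const, Finset.card_univ,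
      Fintype.card_fin, nsmul_eq_mul, one_div, Real.log_inv]
    field_simp
  rw [mutualInfo_eq a (by simpa using hm) (by simpa using hs.ne') hp hρ]
  simp only [hsum, hT, Real.log_one, mul_zero, Finset.sum_const_zero, zero_div, sub_zero,
    Finset.sum_const, Finset.card_univ, nsmul_eq_mul, Fintype.card_prod, Fintype.card_fin]
  push_cast
  rw [Real.logb, Real.log_mul hs'.ne' hs'.ne', Real.log_pow]
  push_cast
  field_simp
  ring

end LSLocking

/-! ### The main theorem -/

theorem lemma6 (s m : ℕ) (hs : 0 < s) (hm : 2 ≤ m)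
    (L : Fin m → LSLocking.Square s)
    (hL : ∀ t, LSLocking.IsLatin (L t) ∨ LSLocking.IsRowSquare (L t) ∨
      LSLocking.IsColumnSquare (L t))
    (horth : ∀ t t', t ≠ t' → LSLocking.AreOrthogonal (L t) (L t'))
    (e : ∀ t, LSLocking.CellOrder (L t))
    (b : Fin m → Fin s × Fin s → EuclideanSpace ℂ (Fin s × Fin s))
    (hb : ∀ t k, b t k = LSLocking.squareBasis (L t) (e t) k)
    (p : Fin m × (Fin s × Fin s) → ℝ) (hp : ∀ x, p x = 1 / ((s : ℝ) ^ 2 * m))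
    (ρ : Fin m × (Fin s × Fin s) → Matrix (Fin s × Fin s) (Fin s × Fin s) ℂ)
    (hρ : ∀ x, ρ x = LSLocking.ketbra (b x.1 x.2)) :
    LSLocking.IsMUBFamily b ∧
      LSLocking.IsAccessibleInfo p ρ (Real.logb 2 ((s : ℝ) ^ 2) / 2) ∧
      LSLocking.mutualInfo p ρ (LSLocking.computationalPOVM (Fin s × Fin s)) =
        Real.logb 2 ((s : ℝ) ^ 2) / 2 := by
  have hmub : LSLocking.IsMUBFamily b := by
    have : b = fun t => LSLocking.squareBasis (L t) (e t) := by
      funext t k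
      exact hb t k
    rw [this]
    exact LSLocking.isMUBFamily_squareBasis hs L horth e
  -- Bundling as `OrthonormalBasis` makes Parseval available.
  let a : Fin m → OrthonormalBasis (Fin s × Fin s) ℂ (EuclideanSpace ℂ (Fin s × Fin s)) :=
    fun t => OrthonormalBasis.mk (hmub.1 t).1 (hmub.1 t).2.ge
  have hab : ∀ t k, a t k = b t k := fun t k => by simp [a]
  have hp' : ∀ x, p x = 1 / ((Fintype.card (Fin s × Fin s) : ℝ) * Fintype.card (Fin m)) := by
    intro x
    rw [hp x]
    simp [sq]
  have hρ' : ∀ x, ρ x = LSLocking.ketbra (a x.1 x.2) := fun x => by rw [hρ, hab]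
  have hcomp := LSLocking.mutualInfo_computationalPOVM hs (by omega) L e a
    (fun t k => (hab t k).trans (hb t k)) hp' hρ'
  refine ⟨hmub, ⟨⟨_, inferInstance, LSLocking.computationalPOVM _, hcomp.symm⟩, ?_⟩, hcomp⟩
  rintro _ ⟨ι, _, M, rfl⟩
  have hcard : (Fintype.card (Fin s × Fin s) : ℝ) = (s : ℝ) ^ 2 := by simp [sq]
  rw [← hcard]
  exact LSLocking.mutualInfo_le_half_log a (by simpa only [hab] using hmub) (by simpa using hm)
    (by simpa using hs.ne') hp' hρ' M
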